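/- Let $n \ge 0$ be an integer, let $\alpha_1, \dots, \alpha_n \in \mathbb{C}[t]$ be polynomials, and let $\alpha = (\alpha_1, \dots, \alpha_n) : \mathbb{C} \to \mathbb{C}^n$, $t \mapsto (\alpha_1(t), \dots, \alpha_n(t))$, be the polynomial map they define. Call $\alpha$ an embedding if $\alpha$ is injective and $\alpha'(t) \neq 0$ for every $t \in \mathbb{C}$. Let $\hat{\alpha} : \mathbb{C}[x_1, \dots, x_n] \to \mathbb{C}[t]$ be the homomorphism of $\mathbb{C}$-algebras determined by $\hat{\alpha}(x_i) = \alpha_i(t)$ for $i = 1, \dots, n$. Then $\alpha$ is an embedding if and only if $\hat{\alpha}$ is surjective. -/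

import Mathlib

namespace PolynomialKnot

/-- The polynomial map `ℂ → ℂⁿ`, `t ↦ (α₁(t), …, αₙ(t))`, with components `α i`. -/
def toMap {n : ℕ} (α : Fin n → Polynomial ℂ) : ℂ → (Fin n → ℂ) :=
  fun t i => (α i).eval t

/-- A polynomial map `ℂ → ℂⁿ` is an embedding if it is injective and its derivative vanishes
nowhere. (A polynomial map is differentiable everywhere, so `deriv` is the actual derivative.) -/
def IsEmbedding {n : ℕ} (α : Fin n → Polynomial ℂ) : Prop :=
  Function.Injective (toMap α) ∧ ∀ t : ℂ, deriv (toMap α) t ≠ 0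

/-- The induced map `ℂ[x₁, …, xₙ] → ℂ[t]` of `ℂ`-algebras, given by `xᵢ ↦ αᵢ(t)`. -/
noncomputable def hat {n : ℕ} (α : Fin n → Polynomial ℂ) :
    MvPolynomial (Fin n) ℂ →ₐ[ℂ] Polynomial ℂ :=
  MvPolynomial.aeval α

end PolynomialKnot

/-!
For each `i` the divided difference `(αᵢ(x) - αᵢ(y)) / (x - y)` is a polynomial in `x` and `y`,
whose value at a diagonal point `(t, t)` is `αᵢ'(t)`. Injectivity away from the diagonal and the
nonvanishing derivative on it say that the divided differences have no common zero, so by the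
Nullstellensatz they generate the unit ideal. Hence `x - y` lies in the ideal generated by the
`αᵢ(x) - αᵢ(y)`, and `α` is injective on points with values in any commutative algebra. This makes
the polynomial ring an epimorphic extension of the image of `α̂`. The extension is also finite, and
a finite epimorphism of commutative rings is surjective.

Conversely, if `α̂` is surjective then `α` is injective on points with values in any commutative
algebra. For the base field this is injectivity of `α`; for the dual numbers it says that the
derivative vanishes nowhere.
-/

open Polynomial TensorProduct
open scoped DualNumber

namespace PolynomialKnot

section DividedDifference

variable {R : Type*} [CommRing R]

/-- The divided difference `(f(x) - f(y)) / (x - y)`, a polynomial in `x = X 0` and `y = X 1`, used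
to treat injectivity and nonvanishing of the derivative as one condition on pairs of points. -/
noncomputable def dividedDifference (f : R[X]) : MvPolynomial (Fin 2) R :=
  ((f.map MvPolynomial.C).evalSubFactor (MvPolynomial.X 0) (MvPolynomial.X 1)).1

theorem aeval_X_sub_aeval_X (f : R[X]) :
    aeval (MvPolynomial.X 0) f - aeval (MvPolynomial.X 1) f =
      dividedDifference f * (MvPolynomial.X 0 - MvPolynomial.X 1) := by
  simpa only [eval_map, ← MvPolynomial.algebraMap_eq] using!
    ((f.map MvPolynomial.C).evalSubFactor (MvPolynomial.X 0) (MvPolynomial.X 1)).2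

variable {S : Type*} [CommRing S] [Algebra R S]

theorem aeval_sub_aeval (f : R[X]) (u v : S) :
    aeval u f - aeval v f = MvPolynomial.aeval ![u, v] (dividedDifference f) * (u - v) := by
  simpa [← aeval_algHom_apply] using
    congrArg (MvPolynomial.aeval ![u, v]) (aeval_X_sub_aeval_X f)

theorem aeval_dividedDifference_self (f : R[X]) (u : S) :
    MvPolynomial.aeval ![u, u] (dividedDifference f) = aeval u (derivative f) := by
  have h := congrArg (MvPolynomial.pderiv 0) (aeval_X_sub_aeval_X f)
  simpa [Derivation.map_aeval, ← aeval_algHom_apply] using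
    congrArg (MvPolynomial.aeval ![u, u]) h.symm

theorem eq_of_aeval_eq_of_span_eq_top {ι : Type*} {α : ι → R[X]}
    (hα : Ideal.span (Set.range fun i => dividedDifference (α i)) = ⊤) {u v : S}
    (huv : ∀ i, aeval u (α i) = aeval v (α i)) : u = v := by
  have hle : Ideal.span (Set.range fun i => dividedDifference (α i)) ≤
      (Ideal.torsionOf S S (u - v)).comap (MvPolynomial.aeval ![u, v]) := by
    refine Ideal.span_le.2 (Set.range_subset_iff.2 fun i => ?_)
    rw [SetLike.mem_coe, Ideal.mem_comap, Ideal.mem_torsionOf_iff, smul_eq_mul,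
      ← aeval_sub_aeval, huv, sub_self]
  have hone := hle (hα ▸ Submodule.mem_top : (1 : MvPolynomial (Fin 2) R) ∈ _)
  simpa [Ideal.mem_torsionOf_iff, sub_eq_zero] using hone

end DividedDifference

theorem span_range_dividedDifference_eq_top {k K ι : Type*} [Field k] [Field K] [IsAlgClosed K]
    [Algebra k K] {α : ι → k[X]}
    (hinj : Function.Injective fun (t : K) i => aeval t (α i))
    (hderiv : ∀ t : K, ∃ i, aeval t (derivative (α i)) ≠ 0) :
    Ideal.span (Set.range fun i => dividedDifference (α i)) = ⊤ := by
  set I := Ideal.span (Set.range fun i => dividedDifference (α i))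
  have hempty : MvPolynomial.zeroLocus K I = ∅ := by
    refine Set.eq_empty_of_forall_notMem fun z hz => ?_
    have hzero (i : ι) : MvPolynomial.aeval ![z 0, z 1] (dividedDifference (α i)) = 0 := by
      rw [show ![z 0, z 1] = z from FinVec.etaExpand_eq z]
      exact hz _ (Ideal.subset_span ⟨i, rfl⟩)
    have hdiag : z 0 = z 1 := hinj <| funext fun i => sub_eq_zero.1 <| by
      rw [aeval_sub_aeval, hzero, zero_mul]
    obtain ⟨i, hi⟩ := hderiv (z 1)
    exact hi (by rw [← aeval_dividedDifference_self, ← hzero i, hdiag])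
  rw [← Ideal.radical_eq_top, ← MvPolynomial.vanishingIdeal_zeroLocus_eq_radical (K := K), hempty,
    MvPolynomial.vanishingIdeal_empty]

section Surjective

variable {R : Type*} [CommRing R] {ι : Type*} {α : ι → R[X]} {S : Type*} [CommRing S] [Algebra R S]

theorem aeval_add_eps (f : R[X]) (u : S) :
    aeval (algebraMap S S[ε] u + ε) f =
      algebraMap S S[ε] (aeval u f) + algebraMap S S[ε] (aeval u (derivative f)) * ε := by
  rw [aeval_add_of_sq_eq_zero _ _ _ DualNumber.eps_pow_two, aeval_algebraMap_apply,
    aeval_algebraMap_apply]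

theorem eq_of_surjective_aeval (hα : Function.Surjective (MvPolynomial.aeval (R := R) α)) {u v : S}
    (huv : ∀ i, aeval u (α i) = aeval v (α i)) : u = v := by
  have h : (aeval u).comp (MvPolynomial.aeval α) = (aeval v).comp (MvPolynomial.aeval α) :=
    MvPolynomial.algHom_ext fun i => by simpa using huv i
  simpa using DFunLike.congr_fun ((AlgHom.cancel_right hα).1 h) X

theorem exists_aeval_derivative_ne_zero_of_surjective_aeval [Nontrivial S]
    (hα : Function.Surjective (MvPolynomial.aeval (R := R) α)) (t : S) :
    ∃ i, aeval t (derivative (α i)) ≠ 0 := by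
  by_contra! hzero
  have h : algebraMap S S[ε] t + ε = algebraMap S S[ε] t := eq_of_surjective_aeval hα fun i => by
    rw [aeval_add_eps, hzero, map_zero, zero_mul, add_zero, aeval_algebraMap_apply]
  simpa using congrArg TrivSqZeroExt.snd h

end Surjective

section Finite

theorem isIntegral_X_of_monic_mem {R : Type*} [CommRing R] (A : Subalgebra R R[X]) {g : R[X]}
    (hg : g.Monic) (hdeg : g.natDegree ≠ 0) (hgA : g ∈ A) : IsIntegral A (X : R[X]) := by
  nontriviality R
  refine .of_aeval_monic (p := g.map (algebraMap R A)) (hg.map _) ?_ ?_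
  · rwa [hg.natDegree_map]
  · rw [aeval_map_algebraMap, aeval_X_left_apply]
    exact isIntegral_algebraMap (x := (⟨g, hgA⟩ : A))

theorem finite_of_monic_mem {R : Type*} [CommRing R] (A : Subalgebra R R[X]) {g : R[X]}
    (hg : g.Monic) (hdeg : g.natDegree ≠ 0) (hgA : g ∈ A) : Module.Finite A R[X] := by
  have hadjoin : Algebra.adjoin A {(X : R[X])} = ⊤ := eq_top_iff.2 fun p _ => by
    simpa using aeval_mem_adjoin_singleton A (X : R[X]) (p := p.map (algebraMap R A))
  exact ⟨by simpa [hadjoin] using (isIntegral_X_of_monic_mem A hg hdeg hgA).fg_adjoin_singleton⟩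

theorem finite_of_natDegree_ne_zero_of_mem {k : Type*} [Field k] (A : Subalgebra k k[X]) {f : k[X]}
    (hdeg : f.natDegree ≠ 0) (hf : f ∈ A) : Module.Finite A k[X] := by
  have hf0 : f ≠ 0 := fun h => hdeg (by rw [h, natDegree_zero])
  exact finite_of_monic_mem A (monic_mul_leadingCoeff_inv hf0)
    (by rwa [natDegree_mul_leadingCoeff_inv f hf0]) (A.mul_mem hf (A.algebraMap_mem _))

end Finite

theorem isEpi_of_forall_eq_of_aeval_eq {R ι : Type*} [CommRing R] {α : ι → R[X]}
    (A : Subalgebra R R[X]) (hA : ∀ i, α i ∈ A)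
    (hmono : ∀ u v : R[X] ⊗[A] R[X], (∀ i, aeval u (α i) = aeval v (α i)) → u = v) :
    Algebra.IsEpi A R[X] := by
  let left : R[X] →ₐ[R] R[X] ⊗[A] R[X] := Algebra.TensorProduct.includeLeft
  let right : R[X] →ₐ[R] R[X] ⊗[A] R[X] :=
    (Algebra.TensorProduct.includeRight : R[X] →ₐ[A] R[X] ⊗[A] R[X]).restrictScalars R
  have hα (i : ι) : left (α i) = right (α i) :=
    Algebra.TensorProduct.tmul_one_eq_one_tmul (⟨α i, hA i⟩ : A)
  have hX : left X = right X := hmono _ _ fun i => by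
    rw [aeval_algHom_apply, aeval_algHom_apply, aeval_X_left_apply, hα]
  have hleft_right : left = right := algHom_ext hX
  exact (Algebra.isEpi_iff_forall_one_tmul_eq A R[X]).2 fun p =>
    (DFunLike.congr_fun hleft_right p).symm

theorem surjective_aeval_of_injective_of_derivative_ne_zero {k K ι : Type*} [Field k] [Field K]
    [IsAlgClosed K] [Algebra k K] {α : ι → k[X]}
    (hinj : Function.Injective fun (t : K) i => aeval t (α i))
    (hderiv : ∀ t : K, ∃ i, aeval t (derivative (α i)) ≠ 0) :
    Function.Surjective (MvPolynomial.aeval (R := k) α) := by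
  let A := (MvPolynomial.aeval (R := k) α).range
  have hA (i : ι) : α i ∈ A := ⟨MvPolynomial.X i, MvPolynomial.aeval_X α i⟩
  have hfinite : Module.Finite A k[X] := by
    obtain ⟨i, hi⟩ := hderiv 0
    exact finite_of_natDegree_ne_zero_of_mem A
      (fun hdeg => hi (by rw [derivative_of_natDegree_zero hdeg, map_zero])) (hA i)
  have hepi : Algebra.IsEpi A k[X] := isEpi_of_forall_eq_of_aeval_eq A hA fun _ _ =>
    eq_of_aeval_eq_of_span_eq_top (span_range_dividedDifference_eq_top hinj hderiv)
  intro p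
  obtain ⟨⟨_, hp⟩, rfl⟩ := Algebra.isEpi_iff_surjective_algebraMap_of_finite.1 hepi p
  exact hp

theorem hasDerivAt_toMap {n : ℕ} (α : Fin n → ℂ[X]) (t : ℂ) :
    HasDerivAt (toMap α) (fun i => (derivative (α i)).eval t) t :=
  hasDerivAt_pi.2 fun i => (α i).hasDerivAt t

theorem isEmbedding_iff {n : ℕ} {α : Fin n → ℂ[X]} :
    IsEmbedding α ↔ (Function.Injective fun (t : ℂ) i => aeval t (α i)) ∧
      ∀ t : ℂ, ∃ i, aeval t (derivative (α i)) ≠ 0 := by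
  simp only [IsEmbedding, (hasDerivAt_toMap α _).deriv, Function.ne_iff, coe_aeval_eq_eval]
  rfl

end PolynomialKnot

theorem mainTheorem11_general {k K ι : Type*} [Field k] [Field K] [IsAlgClosed K] [Algebra k K]
    (α : ι → k[X]) :
    ((Function.Injective fun (t : K) i => aeval t (α i)) ∧
      ∀ t : K, ∃ i, aeval t (derivative (α i)) ≠ 0) ↔
      Function.Surjective (MvPolynomial.aeval (R := k) α) :=
  ⟨fun ⟨hinj, hderiv⟩ =>
      PolynomialKnot.surjective_aeval_of_injective_of_derivative_ne_zero hinj hderiv,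
    fun h => ⟨fun _ _ hst => PolynomialKnot.eq_of_surjective_aeval h (congrFun hst),
      PolynomialKnot.exists_aeval_derivative_ne_zero_of_surjective_aeval h⟩⟩

theorem mainTheorem11 (n : ℕ) (α : Fin n → Polynomial ℂ) :
    PolynomialKnot.IsEmbedding α ↔ Function.Surjective (PolynomialKnot.hat α) :=
  PolynomialKnot.isEmbedding_iff.trans (mainTheorem11_general α)
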